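/- Let $\Gamma$ be a countable abelian group (written additively, with the discrete topology), $\widehat\Gamma$ its compact dual group, and $dk$ normalized Haar measure on $\widehat\Gamma$. Let $\alpha$ be an injective endomorphism of $\Gamma$ such that $\alpha(\Gamma)$ has finite index in $\Gamma$ and $\bigcap_{n\ge 0}\alpha^n(\Gamma)=\{0\}$. Let $\alpha^*$ be the endomorphism $\omega\mapsto\omega\circ\alpha$ of $\widehat\Gamma$, and let $N:=|\ker\alpha^*|$, which is finite. A filter for $\alpha^*$ is a Borel function $m:\widehat\Gamma\to\mathbb C$ such that $\sum_{a\in\ker\alpha^*}|m(ak)|^2=N$ for almost every $k\in\widehat\Gamma$. Let $m$ be a filter for $\alpha^*$ such that $m^{-1}(0)$ has Haar measure zero. Then: * $(S_mf)(k)=m(k)f(\alpha^*(k))$ defines an isometry $S_m$ of $L^2(\widehat\Gamma)$, and $(\mu_\gamma f)(k)=k(\gamma)f(k)$ defines a unitary representation $\mu$ of $\Gamma$ on $L^2(\widehat\Gamma)$ with $S_m\mu_\gamma=\mu_{\alpha(\gamma)}S_m$. Let $(L^2(\widehat\Gamma)_\infty,(U_n)_{n\ge0})$ be the Hilbert-space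 direct limit of $L^2(\widehat\Gamma)\xrightarrow{S_m}L^2(\widehat\Gamma)\xrightarrow{S_m}\cdots$, so that $U_{n+1}S_m=U_n$; let $S_\infty$ be the unitary operator on $L^2(\widehat\Gamma)_\infty$ determined by $S_\infty U_n=U_nS_m$, and $\mu_\infty$ the unitary representation of $\Gamma$ determined by $\mu_\infty(\gamma)U_n=U_n\mu_{\alpha^n(\gamma)}$. * Let $\mathcal S_{\alpha^*}=\{\zeta=(\zeta_n)_{n\ge0}\in\widehat\Gamma^{\mathbb N}:\alpha^*(\zeta_{n+1})=\zeta_n \text{ for all } n\}$ be the solenoid $\varprojlim(\widehat\Gamma,\alpha^*)$, with $\pi_n(\zeta)=\zeta_n$ and shift $h(\zeta_0,\zeta_1,\dots)=(\alpha^*(\zeta_0),\zeta_0,\zeta_1,\dots)$. Let $\tau$ be the unique Borel probability measure on $\mathcal S_{\alpha^*}$ such that $\int (f\circ\pi_n)\,d\tau=\int_{\widehat\Gamma} f(k)\prod_{j=0}^{n-1}|m(\alpha^{*j}(k))|^2\,dk$ for all $n\ge0$ and $f\in C(\widehat\Gamma)$. There is a unitary isomorphism $V_\infty$ of $L^2(\mathcal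 S_{\alpha^*},\tau)$ onto $L^2(\widehat\Gamma)_\infty$ such that (a) for every $n\ge0$ and every $g\in L^2\big(\widehat\Gamma,\prod_{j=0}^{n-1}|m(\alpha^{*j}(k))|^2\,dk\big)$, we have $g\circ\pi_n\in L^2(\mathcal S_{\alpha^*},\tau)$, $g\prod_{j=0}^{n-1}(m\circ\alpha^{*j})\in L^2(\widehat\Gamma)$, and $V_\infty(g\circ\pi_n)=U_n\big(g\prod_{j=0}^{n-1}(m\circ\alpha^{*j})\big)$; (b) for every $f\in L^2(\mathcal S_{\alpha^*},\tau)$, $(V_\infty^*S_\infty V_\infty f)(\zeta)=m(\pi_0(\zeta))f(h(\zeta))$ for $\tau$-almost every $\zeta$; (c) for every $\gamma\in\Gamma$ and $f\in L^2(\mathcal S_{\alpha^*},\tau)$, $(V_\infty^*\mu_\infty(\gamma)V_\infty f)(\zeta)=\pi_0(\zeta)(\gamma)f(\zeta)$ for $\tau$-almost every $\zeta$. -/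

import Mathlib

open MeasureTheory Filter Topology
open scoped ENNReal

noncomputable section

section HilbertDirectLimit

universe u

variable {H : Type u} [NormedAddCommGroup H] [InnerProductSpace ℂ H]

/-- The connecting maps `S ^ (j - i) : H_i → H_j` of the direct system `H → H → H → ⋯`. -/
def isometrySystem (S : H →ₗᵢ[ℂ] H) (i j : ℕ) (_ : i ≤ j) : H →ₗᵢ[ℂ] H := S ^ (j - i)

instance isometrySystem_directed (S : H →ₗᵢ[ℂ] H) :
    DirectedSystem (fun _ : ℕ => H) (fun i j h => ⇑(isometrySystem S i j h)) where
  map_self i x := by simp [isometrySystem]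
  map_map k j i hij hjk x := by
    have : k - i = (k - j) + (j - i) := by omega
    simp only [isometrySystem, this, pow_add, LinearIsometry.coe_mul, Function.comp_apply]

/-- The algebraic (vector space) direct limit of `H → H → H → ⋯`. -/
def AlgDirectLimit (S : H →ₗᵢ[ℂ] H) : Type u :=
  DirectLimit (fun _ : ℕ => H) (isometrySystem S)

instance (S : H →ₗᵢ[ℂ] H) : AddCommGroup (AlgDirectLimit S) :=
  inferInstanceAs (AddCommGroup (DirectLimit (fun _ : ℕ => H) (isometrySystem S)))

instance (S : H →ₗᵢ[ℂ] H) : Module ℂ (AlgDirectLimit S) :=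
  inferInstanceAs (Module ℂ (DirectLimit (fun _ : ℕ => H) (isometrySystem S)))

/-- The canonical map of the `n`th copy of `H` into the algebraic direct limit. -/
def algOf (S : H →ₗᵢ[ℂ] H) (n : ℕ) : H →ₗ[ℂ] AlgDirectLimit S :=
  DirectLimit.Module.of ℂ ℕ (fun _ : ℕ => H) (isometrySystem S) n

/-- The (semi-)inner product on the algebraic direct limit, determined by
`⟪[n, x], [n, y]⟫ = ⟪x, y⟫`. -/
@[reducible]
def algDirectLimitCore (S : H →ₗᵢ[ℂ] H) : PreInnerProductSpace.Core ℂ (AlgDirectLimit S) where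
  inner := DirectLimit.lift₂ _ _ (fun _ x y => inner ℂ x y)
    (fun i j h x y => ((isometrySystem S i j h).inner_map_map x y).symm)
  conj_inner_symm := DirectLimit.induction₂ _ fun i x y => by
    simp only [DirectLimit.lift₂_def, inner_conj_symm]
  re_inner_nonneg := DirectLimit.induction _ fun i x => by
    simp only [DirectLimit.lift₂_def]
    exact inner_self_nonneg
  add_left := DirectLimit.induction₃ _ fun i x y z => by
    have h : ∀ a b : H, (⟦⟨i, a⟩⟧ + ⟦⟨i, b⟩⟧ : DirectLimit (fun _ : ℕ => H) (isometrySystem S))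
      = ⟦⟨i, a + b⟩⟧ := fun a b => DirectLimit.add_def ..
    erw [h]
    simp only [DirectLimit.lift₂_def, inner_add_left]
  smul_left x y r := by
    induction x, y using DirectLimit.induction₂ with
    | ih i x y =>
      have h : (r • ⟦⟨i, x⟩⟧ : DirectLimit (fun _ : ℕ => H) (isometrySystem S))
        = ⟦⟨i, r • x⟩⟧ := DirectLimit.smul_def ..
      erw [h]
      simp only [DirectLimit.lift₂_def, inner_smul_left]

instance (S : H →ₗᵢ[ℂ] H) : SeminormedAddCommGroup (AlgDirectLimit S) :=
  @InnerProductSpace.Core.toSeminormedAddCommGroup ℂ _ _ _ _ (algDirectLimitCore S)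

instance (S : H →ₗᵢ[ℂ] H) : InnerProductSpace ℂ (AlgDirectLimit S) :=
  InnerProductSpace.ofCore (algDirectLimitCore S)

/-- The Hilbert space direct limit `H_∞` of the direct system `(H_n, T_n) = (H, S)`: the completion
of the algebraic direct limit. -/
abbrev HilbertDirectLimit (S : H →ₗᵢ[ℂ] H) : Type u :=
  UniformSpace.Completion (AlgDirectLimit S)

namespace HilbertDirectLimit

theorem inner_algOf (S : H →ₗᵢ[ℂ] H) (n : ℕ) (x y : H) :
    inner ℂ (algOf S n x) (algOf S n y) = inner ℂ x y :=
  DirectLimit.lift₂_def (isometrySystem S) (isometrySystem S) (fun _ x y => inner ℂ x y)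
    (fun i j h x y => ((isometrySystem S i j h).inner_map_map x y).symm) n x y

/-- The canonical isometry `U_n` of the `n`th copy of `H` into `H_∞`. -/
def U (S : H →ₗᵢ[ℂ] H) (n : ℕ) : H →ₗᵢ[ℂ] HilbertDirectLimit S :=
  UniformSpace.Completion.toComplₗᵢ.comp
    ((algOf S n).isometryOfInner (inner_algOf S n))

/-- The maps `U_n` are compatible with the direct system. -/
theorem U_succ (S : H →ₗᵢ[ℂ] H) (n : ℕ) (x : H) : U S (n + 1) (S x) = U S n x := by
  have h : algOf S (n + 1) (S x) = algOf S n x := by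
    have h1 : isometrySystem S n (n + 1) (Nat.le_succ n) x = S x := by simp [isometrySystem]
    rw [← h1]
    exact DirectLimit.Module.of_f (R := ℂ) (G := fun _ : ℕ => H) (f := isometrySystem S)
      (hij := Nat.le_succ n) (x := x)
  exact congrArg ((↑) : AlgDirectLimit S → HilbertDirectLimit S) h

/-- The union of the ranges of the `U_n` is dense. -/
theorem dense_U (S : H →ₗᵢ[ℂ] H) : Dense (⋃ n, Set.range (U S n)) := by
  refine (UniformSpace.Completion.denseRange_coe (α := AlgDirectLimit S)).mono ?_
  rintro _ ⟨x, rfl⟩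
  induction x using DirectLimit.induction with
  | ih n x => exact Set.mem_iUnion.2 ⟨n, x, rfl⟩

/-- Continuous maps on `H_∞` which agree on the ranges of the `U_n` are equal. -/
theorem ext_U {S : H →ₗᵢ[ℂ] H} {Y : Type*} [TopologicalSpace Y] [T2Space Y]
    {f g : HilbertDirectLimit S → Y} (hf : Continuous f) (hg : Continuous g)
    (h : ∀ n x, f (U S n x) = g (U S n x)) : f = g :=
  Continuous.ext_on (dense_U S) hf hg fun z hz => by
    obtain ⟨n, x, rfl⟩ := Set.mem_iUnion.1 hz
    exact h n x

variable {K : Type*} [NormedAddCommGroup K] [InnerProductSpace ℂ K] [CompleteSpace K]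

/-- The map on the algebraic direct limit induced by a compatible family of isometries. -/
def algLift (S : H →ₗᵢ[ℂ] H) (R : ℕ → H →ₗᵢ[ℂ] K) (hR : ∀ n x, R (n + 1) (S x) = R n x) :
    AlgDirectLimit S →ₗᵢ[ℂ] K :=
  have hR' : ∀ i j (h : i ≤ j) (x : H), R j (isometrySystem S i j h x) = R i x := by
    intro i j h x
    obtain ⟨k, rfl⟩ := Nat.exists_eq_add_of_le h
    induction k with
    | zero => simp [isometrySystem]
    | succ k ih =>
      have h1 : isometrySystem S i (i + (k + 1)) h x =
          S (isometrySystem S i (i + k) (Nat.le_add_right i k) x) := by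
        have h2 : i + (k + 1) - i = (i + k - i) + 1 := by omega
        simp only [isometrySystem, h2, pow_succ', LinearIsometry.coe_mul, Function.comp_apply]
      rw [h1, ← ih (Nat.le_add_right i k)]
      exact hR (i + k) _
  let L : AlgDirectLimit S →ₗ[ℂ] K :=
    DirectLimit.Module.lift ℂ ℕ (fun _ : ℕ => H) (isometrySystem S)
      (fun n => (R n).toLinearMap) hR'
  L.isometryOfInner (DirectLimit.induction₂ _ fun n x y =>
    ((R n).inner_map_map x y).trans (inner_algOf S n x y).symm)

/-- The universal property of the direct limit: isometries `R_n : H → K` with `R_{n+1} S = R_n`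
induce an isometry `R_∞ : H_∞ → K` with `R_∞ U_n = R_n`. -/
def lift (S : H →ₗᵢ[ℂ] H) (R : ℕ → H →ₗᵢ[ℂ] K) (hR : ∀ n x, R (n + 1) (S x) = R n x) :
    HilbertDirectLimit S →ₗᵢ[ℂ] K where
  toLinearMap := ((algLift S R hR).toContinuousLinearMap.extend
    (UniformSpace.Completion.toComplL (𝕜 := ℂ))).toLinearMap
  norm_map' := by
    refine congrFun (f := fun x => ‖((algLift S R hR).toContinuousLinearMap.extend
      (UniformSpace.Completion.toComplL (𝕜 := ℂ))) x‖) (g := fun x => ‖x‖) ?_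
    refine UniformSpace.Completion.ext (by fun_prop) (by fun_prop) fun a => ?_
    have := ContinuousLinearMap.extend_eq (algLift S R hR).toContinuousLinearMap
      (e := UniformSpace.Completion.toComplL (𝕜 := ℂ))
      UniformSpace.Completion.denseRange_coe
      (UniformSpace.Completion.isUniformInducing_coe _) a
    rw [UniformSpace.Completion.coe_toComplL] at this
    simp [this]

theorem lift_U (S : H →ₗᵢ[ℂ] H) (R : ℕ → H →ₗᵢ[ℂ] K) (hR : ∀ n x, R (n + 1) (S x) = R n x)
    (n : ℕ) (x : H) : lift S R hR (U S n x) = R n x :=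
  ContinuousLinearMap.extend_eq (algLift S R hR).toContinuousLinearMap
    (e := UniformSpace.Completion.toComplL (𝕜 := ℂ))
    UniformSpace.Completion.denseRange_coe
    (UniformSpace.Completion.isUniformInducing_coe _) (algOf S n x)

/-- The unitary `S_∞` on `H_∞`, determined by `S_∞ U_n = U_n S`. -/
def dilation (S : H →ₗᵢ[ℂ] H) : HilbertDirectLimit S ≃ₗᵢ[ℂ] HilbertDirectLimit S :=
  let D := lift S (fun n => (U S n).comp S) fun n x => U_succ S n (S x)
  let E := lift S (fun n => U S (n + 1)) fun n x => U_succ S (n + 1) x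
  have hD : ∀ n x, D (U S n x) = U S n (S x) := lift_U S _ _
  have hE : ∀ n x, E (U S n x) = U S (n + 1) x := lift_U S _ _
  { toLinearEquiv := LinearEquiv.ofLinearMap D.toLinearMap E.toLinearMap
      (LinearMap.ext fun z => congrFun (ext_U (D.continuous.comp E.continuous) continuous_id
        fun n x => show D (E (U S n x)) = U S n x by rw [hE, hD, U_succ]) z)
      (LinearMap.ext fun z => congrFun (ext_U (E.continuous.comp D.continuous) continuous_id
        fun n x => show E (D (U S n x)) = U S n x by rw [hD, hE, U_succ]) z)
    norm_map' := D.norm_map }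

theorem dilation_U (S : H →ₗᵢ[ℂ] H) (n : ℕ) (x : H) : dilation S (U S n x) = U S n (S x) :=
  lift_U S _ _ n x

section Translation

variable {Γ : Type*} [AddCommGroup Γ]

/-- The isometry `μ_∞(γ)` on `H_∞`, determined by `μ_∞(γ) U_n = U_n μ(α^n(γ))`. -/
def translationIsometry (S : H →ₗᵢ[ℂ] H) (α : Γ →+ Γ) (μ : Multiplicative Γ →* (H ≃ₗᵢ[ℂ] H))
    (hμ : ∀ γ x, S (μ (.ofAdd γ) x) = μ (.ofAdd (α γ)) (S x)) (γ : Γ) :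
    HilbertDirectLimit S →ₗᵢ[ℂ] HilbertDirectLimit S :=
  lift S (fun n => (U S n).comp (μ (.ofAdd (α^[n] γ))).toLinearIsometry) fun n x => by
    change U S (n + 1) (μ (.ofAdd (α^[n + 1] γ)) (S x)) = U S n (μ (.ofAdd (α^[n] γ)) x)
    rw [Function.iterate_succ_apply', ← hμ, U_succ]

theorem translationIsometry_U (S : H →ₗᵢ[ℂ] H) (α : Γ →+ Γ)
    (μ : Multiplicative Γ →* (H ≃ₗᵢ[ℂ] H))
    (hμ : ∀ γ x, S (μ (.ofAdd γ) x) = μ (.ofAdd (α γ)) (S x)) (γ : Γ) (n : ℕ) (x : H) :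
    translationIsometry S α μ hμ γ (U S n x) = U S n (μ (.ofAdd (α^[n] γ)) x) :=
  lift_U S _ _ n x

theorem translationIsometry_add (S : H →ₗᵢ[ℂ] H) (α : Γ →+ Γ)
    (μ : Multiplicative Γ →* (H ≃ₗᵢ[ℂ] H))
    (hμ : ∀ γ x, S (μ (.ofAdd γ) x) = μ (.ofAdd (α γ)) (S x)) (γ δ : Γ)
    (z : HilbertDirectLimit S) :
    translationIsometry S α μ hμ (γ + δ) z =
      translationIsometry S α μ hμ γ (translationIsometry S α μ hμ δ z) := by
  refine congrFun (ext_U (LinearIsometry.continuous _)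
    ((LinearIsometry.continuous _).comp (LinearIsometry.continuous _)) fun n x => ?_) z
  simp only [translationIsometry_U, Function.comp_apply, iterate_map_add, ofAdd_add, map_mul,
    LinearIsometryEquiv.coe_mul]

theorem translationIsometry_zero (S : H →ₗᵢ[ℂ] H) (α : Γ →+ Γ)
    (μ : Multiplicative Γ →* (H ≃ₗᵢ[ℂ] H))
    (hμ : ∀ γ x, S (μ (.ofAdd γ) x) = μ (.ofAdd (α γ)) (S x)) (z : HilbertDirectLimit S) :
    translationIsometry S α μ hμ 0 z = z := by
  refine congrFun (g := id) (ext_U (LinearIsometry.continuous _) continuous_id fun n x => ?_) z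
  simp [translationIsometry_U, iterate_map_zero]

/-- The unitary representation `μ_∞` of `Γ` on `H_∞`, determined by
`μ_∞(γ) U_n = U_n μ(α^n(γ))`. -/
def translation (S : H →ₗᵢ[ℂ] H) (α : Γ →+ Γ) (μ : Multiplicative Γ →* (H ≃ₗᵢ[ℂ] H))
    (hμ : ∀ γ x, S (μ (.ofAdd γ) x) = μ (.ofAdd (α γ)) (S x)) :
    Multiplicative Γ →* (HilbertDirectLimit S ≃ₗᵢ[ℂ] HilbertDirectLimit S) where
  toFun γ :=
    { toLinearEquiv := LinearEquiv.ofLinearMap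
        (translationIsometry S α μ hμ γ.toAdd).toLinearMap
        (translationIsometry S α μ hμ (-γ.toAdd)).toLinearMap
        (LinearMap.ext fun z => by
          simp [← translationIsometry_add, translationIsometry_zero])
        (LinearMap.ext fun z => by
          simp [← translationIsometry_add, translationIsometry_zero])
      norm_map' := (translationIsometry S α μ hμ γ.toAdd).norm_map }
  map_one' := LinearIsometryEquiv.ext (translationIsometry_zero S α μ hμ)
  map_mul' γ δ := LinearIsometryEquiv.ext (translationIsometry_add S α μ hμ γ.toAdd δ.toAdd)

theorem translation_U (S : H →ₗᵢ[ℂ] H) (α : Γ →+ Γ) (μ : Multiplicative Γ →* (H ≃ₗᵢ[ℂ] H))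
    (hμ : ∀ γ x, S (μ (.ofAdd γ) x) = μ (.ofAdd (α γ)) (S x)) (γ : Γ) (n : ℕ) (x : H) :
    translation S α μ hμ (.ofAdd γ) (U S n x) = U S n (μ (.ofAdd (α^[n] γ)) x) :=
  translationIsometry_U S α μ hμ γ n x

end Translation

end HilbertDirectLimit

end HilbertDirectLimit

section WeightedComposition

variable {X Y : Type*} [MeasurableSpace X] [MeasurableSpace Y] {μ : Measure X} {ν : Measure Y}

/-- Data for a weighted composition operator `f ↦ w · (f ∘ φ)` which is isometric from `L²(ν)` to
`L²(μ)`. -/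
structure IsIsometricWeight (w : X → ℂ) (φ : X → Y) (μ : Measure X) (ν : Measure Y) : Prop where
  measurable : Measurable w
  quasi : Measure.QuasiMeasurePreserving φ μ ν
  lintegral_eq : ∀ g : Y → ℝ≥0∞, Measurable g → ∫⁻ x, ‖w x‖ₑ ^ 2 * g (φ x) ∂μ = ∫⁻ y, g y ∂ν

theorem IsIsometricWeight.eLpNorm_eq {w : X → ℂ} {φ : X → Y} (h : IsIsometricWeight w φ μ ν)
    {f : Y → ℂ} (hf : AEStronglyMeasurable f ν) :
    eLpNorm (fun x => w x * f (φ x)) 2 μ = eLpNorm f 2 ν := by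
  have key : ∫⁻ x, ‖w x * f (φ x)‖ₑ ^ 2 ∂μ = ∫⁻ y, ‖f y‖ₑ ^ 2 ∂ν := by
    have h1 : ∫⁻ x, ‖w x * f (φ x)‖ₑ ^ 2 ∂μ = ∫⁻ x, ‖w x‖ₑ ^ 2 * ‖hf.mk f (φ x)‖ₑ ^ 2 ∂μ := by
      refine lintegral_congr_ae ?_
      filter_upwards [h.quasi.ae_eq_comp hf.ae_eq_mk] with x hx
      simp only [Function.comp_apply] at hx
      rw [hx, enorm_mul, mul_pow]
    have h2 : ∫⁻ y, ‖f y‖ₑ ^ 2 ∂ν = ∫⁻ y, ‖hf.mk f y‖ₑ ^ 2 ∂ν := by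
      refine lintegral_congr_ae ?_
      filter_upwards [hf.ae_eq_mk] with y hy
      rw [← hy]
    rw [h1, h2]
    exact h.lintegral_eq _ (hf.stronglyMeasurable_mk.measurable.enorm.pow_const 2)
  simp only [eLpNorm_eq_lintegral_rpow_enorm_toReal two_ne_zero ENNReal.ofNat_ne_top,
    ENNReal.toReal_ofNat, ENNReal.rpow_ofNat]
  rw [key]

theorem IsIsometricWeight.memLp {w : X → ℂ} {φ : X → Y} (h : IsIsometricWeight w φ μ ν)
    {f : Y → ℂ} (hf : MemLp f 2 ν) : MemLp (fun x => w x * f (φ x)) 2 μ :=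
  ⟨h.measurable.aestronglyMeasurable.mul (hf.1.comp_quasiMeasurePreserving h.quasi), by
    rw [h.eLpNorm_eq hf.1]; exact hf.2⟩

/-- The isometry `f ↦ w · (f ∘ φ)` from `L²(ν)` into `L²(μ)`. -/
def weightedComp {w : X → ℂ} {φ : X → Y} (h : IsIsometricWeight w φ μ ν) :
    Lp ℂ 2 ν →ₗᵢ[ℂ] Lp ℂ 2 μ where
  toFun f := (h.memLp (Lp.memLp f)).toLp (fun x => w x * f (φ x))
  map_add' f g := by
    rw [← MemLp.toLp_add]
    refine MemLp.toLp_congr _ _ ?_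
    filter_upwards [h.quasi.ae_eq_comp (Lp.coeFn_add f g)] with x hx
    simp only [Function.comp_apply, Pi.add_apply] at hx
    simp only [hx, Pi.add_apply, mul_add]
  map_smul' c f := by
    rw [RingHom.id_apply, ← MemLp.toLp_const_smul]
    refine MemLp.toLp_congr _ _ ?_
    filter_upwards [h.quasi.ae_eq_comp (Lp.coeFn_smul c f)] with x hx
    simp only [Function.comp_apply, Pi.smul_apply, smul_eq_mul] at hx
    simp only [hx, Pi.smul_apply, smul_eq_mul]
    ring
  norm_map' f := by
    change ‖(h.memLp (Lp.memLp f)).toLp (fun x => w x * f (φ x))‖ = ‖f‖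
    rw [Lp.norm_toLp (fun x => w x * f (φ x)) (h.memLp (Lp.memLp f)), h.eLpNorm_eq (Lp.memLp f).1, Lp.norm_def]

theorem coeFn_weightedComp {w : X → ℂ} {φ : X → Y} (h : IsIsometricWeight w φ μ ν)
    (f : Lp ℂ 2 ν) : weightedComp h f =ᵐ[μ] fun x => w x * f (φ x) :=
  MemLp.coeFn_toLp (h.memLp (Lp.memLp f))

end WeightedComposition

section Dual

/-- The dual group `Γ̂` of an additive group `Γ`: continuous characters `Γ → 𝕋`, with the topology of
uniform convergence on compact sets. -/
abbrev DualGroup (Γ : Type*) [AddCommGroup Γ] [TopologicalSpace Γ] : Type _ :=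
  PontryaginDual (Multiplicative Γ)

variable {Γ : Type*} [AddCommGroup Γ] [TopologicalSpace Γ]

instance : MeasurableSpace (DualGroup Γ) := borel _

instance : BorelSpace (DualGroup Γ) := ⟨rfl⟩

/-- The value `k(γ)`, as a complex number, of the character `k ∈ Γ̂` at `γ ∈ Γ`. -/
def DualGroup.eval (k : DualGroup Γ) (γ : Γ) : ℂ := (k (Multiplicative.ofAdd γ) : ℂ)

theorem DualGroup.continuous_eval (γ : Γ) : Continuous fun k : DualGroup Γ => k.eval γ := by
  have h := ContinuousMonoidHom.isInducing_toContinuousMap (Multiplicative Γ) Circle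
  have h2 : Continuous fun f : C(Multiplicative Γ, Circle) => f (Multiplicative.ofAdd γ) :=
    ContinuousEvalConst.continuous_eval_const _
  exact continuous_subtype_val.comp (h2.comp h.continuous)

variable [DiscreteTopology Γ]

/-- The endomorphism `α^* : k ↦ k ∘ α` of `Γ̂` dual to `α`. -/
def dualEndo (α : Γ →+ Γ) : DualGroup Γ →ₜ* DualGroup Γ :=
  PontryaginDual.map ⟨AddMonoidHom.toMultiplicative α, continuous_of_discreteTopology⟩

theorem dualEndo_eval (α : Γ →+ Γ) (k : DualGroup Γ) (γ : Γ) :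
    (dualEndo α k).eval γ = k.eval (α γ) := rfl

variable (Γ) in
/-- Normalized Haar measure on the compact group `Γ̂`. -/
def haarDual : Measure (DualGroup Γ) := Measure.haarMeasure ⊤

instance : (haarDual Γ).IsHaarMeasure := by unfold haarDual; infer_instance

instance : IsProbabilityMeasure (haarDual Γ) :=
  ⟨by simpa [haarDual] using Measure.haarMeasure_self (K₀ := (⊤ : TopologicalSpace.PositiveCompacts (DualGroup Γ)))⟩

instance [Countable Γ] : SecondCountableTopology (DualGroup Γ) := by
  have : Countable (Multiplicative Γ) := inferInstanceAs (Countable Γ)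
  have h := ContinuousMonoidHom.isInducing_toContinuousMap (Multiplicative Γ) Circle
  exact h.secondCountableTopology

/-- The standing assumptions on the endomorphism `α` of `Γ`: it is injective, `α(Γ)` has finite
index in `Γ`, and `⋂ₙ αⁿ(Γ) = {0}`. -/
structure IsDilationEndo {Γ : Type*} [AddCommGroup Γ] (α : Γ →+ Γ) : Prop where
  injective : Function.Injective α
  finiteIndex : α.range.FiniteIndex
  iInter_range : ⋂ n : ℕ, Set.range (α^[n]) = {0}

theorem dualEndo_surjective {α : Γ →+ Γ} (hα : Function.Injective α) :
    Function.Surjective (dualEndo α) := by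
  intro k
  have hdiv : DivisibleBy (Additive Circle) ℤ := divisibleByOfSMulRightSurj _ _ <| by
    intro n hn z
    obtain ⟨t, ht⟩ := Circle.exp_surjective z.toMul
    refine ⟨Additive.ofMul (Circle.exp (t / n)), ?_⟩
    have h : Circle.exp (t / n) ^ n = z.toMul := by
      rw [← Circle.exp_zsmul, ← ht, zsmul_eq_mul, mul_div_cancel₀ _ (by exact_mod_cast hn)]
    exact h
  obtain ⟨l, hl⟩ := Module.Baer.extension_property_addMonoidHom
    (Module.Baer.of_divisible (Additive Circle)) α hα
    (AddMonoidHom.toMultiplicativeLeft.symm (k : Multiplicative Γ →ₜ* Circle).toMonoidHom)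
  refine ⟨(⟨AddMonoidHom.toMultiplicativeLeft l, continuous_of_discreteTopology⟩ :
    Multiplicative Γ →ₜ* Circle), PontryaginDual.ext fun γ => ?_⟩
  exact congrArg Additive.toMul (DFunLike.congr_fun hl γ.toAdd)

theorem measurePreserving_dualEndo {α : Γ →+ Γ} (hα : Function.Injective α) :
    MeasurePreserving (dualEndo α) (haarDual Γ) (haarDual Γ) :=
  MonoidHom.measurePreserving (f := (dualEndo α).toMonoidHom) (map_continuous (dualEndo α))
    (dualEndo_surjective hα) (by simp)

theorem finite_ker_dualEndo {α : Γ →+ Γ} (hα : α.range.FiniteIndex) :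
    Finite (dualEndo α).toMonoidHom.ker := by
  let Q := Multiplicative (Γ ⧸ α.range)
  let _ : TopologicalSpace Q := ⊥
  have : DiscreteTopology Q := ⟨rfl⟩
  have : Finite Q := inferInstanceAs (Finite (Γ ⧸ α.range))
  let q : Multiplicative Γ →ₜ* Q :=
    ⟨AddMonoidHom.toMultiplicative (QuotientAddGroup.mk' α.range), continuous_of_discreteTopology⟩
  have hfin : (Set.range (PontryaginDual.map q)).Finite := Set.finite_range _
  refine (hfin.subset fun a ha => ?_).to_subtype
  have ha' : dualEndo α a = 1 := ha
  let f : Γ →+ Additive Circle :=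
    AddMonoidHom.toMultiplicativeLeft.symm (a : Multiplicative Γ →ₜ* Circle).toMonoidHom
  have hf : α.range ≤ f.ker := by
    rintro _ ⟨γ, rfl⟩
    exact congrArg Additive.ofMul (DFunLike.congr_fun ha' (Multiplicative.ofAdd γ))
  refine ⟨(⟨AddMonoidHom.toMultiplicativeLeft (QuotientAddGroup.lift α.range f hf),
    continuous_of_discreteTopology⟩ : Q →ₜ* Circle), PontryaginDual.ext fun γ => ?_⟩
  rfl

/-- A filter for `α^*`: a Borel function `m : Γ̂ → ℂ` such that `∑_{a ∈ ker α^*} |m(ak)|² = N` for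
almost all `k`, where `N = |ker α^*|` (which is finite when `α(Γ)` has finite index). -/
structure IsFilter (α : Γ →+ Γ) (m : DualGroup Γ → ℂ) : Prop where
  measurable : Measurable m
  sum_eq : ∀ᵐ k ∂(haarDual Γ), ∑ᶠ a : (dualEndo α).toMonoidHom.ker, ‖m (a * k)‖ ^ 2 =
    (Nat.card (dualEndo α).toMonoidHom.ker : ℝ)

theorem IsFilter.isIsometricWeight [Countable Γ] {α : Γ →+ Γ} (hα : IsDilationEndo α)
    {m : DualGroup Γ → ℂ} (hm : IsFilter α m) :
    IsIsometricWeight m (dualEndo α) (haarDual Γ) (haarDual Γ) where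
  measurable := hm.measurable
  quasi := (measurePreserving_dualEndo hα.injective).quasiMeasurePreserving
  lintegral_eq g hg := by
    have hβ := (measurePreserving_dualEndo hα.injective)
    have := finite_ker_dualEndo hα.finiteIndex
    have := Fintype.ofFinite (dualEndo α).toMonoidHom.ker
    rw [← hβ.lintegral_comp hg]
    set N := Nat.card (dualEndo α).toMonoidHom.ker with hN
    have hN0 : (N : ℝ≥0∞) ≠ 0 := by
      simp only [hN, ne_eq, Nat.cast_eq_zero]; exact Nat.card_pos.ne'
    have hgm : Measurable fun k => g (dualEndo α k) := hg.comp hβ.measurable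
    have hint : ∀ a : (dualEndo α).toMonoidHom.ker,
        ∫⁻ k, ‖m (a * k)‖ₑ ^ 2 * g (dualEndo α k) ∂(haarDual Γ) =
          ∫⁻ k, ‖m k‖ₑ ^ 2 * g (dualEndo α k) ∂(haarDual Γ) := by
      intro a
      rw [← lintegral_mul_left_eq_self (fun k => ‖m k‖ₑ ^ 2 * g (dualEndo α k)) (a : DualGroup Γ)]
      refine lintegral_congr fun k => ?_
      have ha : dualEndo α a = 1 := a.2
      rw [map_mul, ha, one_mul]
    have hsum : ∫⁻ k, ∑ a : (dualEndo α).toMonoidHom.ker,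
        ‖m (a * k)‖ₑ ^ 2 * g (dualEndo α k) ∂(haarDual Γ) =
          N * ∫⁻ k, ‖m k‖ₑ ^ 2 * g (dualEndo α k) ∂(haarDual Γ) := by
      rw [lintegral_finsetSum]
      · simp only [hint, Finset.sum_const, Finset.card_univ, nsmul_eq_mul, hN,
          Nat.card_eq_fintype_card]
      · intro a _
        exact ((hm.measurable.comp (measurable_const_mul _)).enorm.pow_const 2).mul hgm
    have hsum' : ∫⁻ k, ∑ a : (dualEndo α).toMonoidHom.ker,
        ‖m (a * k)‖ₑ ^ 2 * g (dualEndo α k) ∂(haarDual Γ) =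
          N * ∫⁻ k, g (dualEndo α k) ∂(haarDual Γ) := by
      rw [← lintegral_const_mul _ hgm]
      refine lintegral_congr_ae ?_
      filter_upwards [hm.sum_eq] with k hk
      rw [← Finset.sum_mul]
      congr 1
      rw [finsum_eq_sum_of_fintype] at hk
      have := congrArg ENNReal.ofReal hk
      rw [ENNReal.ofReal_sum_of_nonneg (fun _ _ => by positivity), ENNReal.ofReal_natCast] at this
      rw [← this]
      refine Finset.sum_congr rfl fun a _ => ?_
      rw [ENNReal.ofReal_pow (norm_nonneg _), ofReal_norm]
    exact (ENNReal.mul_right_inj hN0 (ENNReal.natCast_ne_top N)).1 (hsum.symm.trans hsum')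

/-- The isometry `S_m` on `L²(Γ̂)`, `(S_m f)(k) = m(k) f(α^*(k))`. -/
def filterIsometry [Countable Γ] {α : Γ →+ Γ} (hα : IsDilationEndo α) {m : DualGroup Γ → ℂ}
    (hm : IsFilter α m) : Lp ℂ 2 (haarDual Γ) →ₗᵢ[ℂ] Lp ℂ 2 (haarDual Γ) :=
  weightedComp (hm.isIsometricWeight hα)

theorem isIsometricWeight_eval (γ : Γ) :
    IsIsometricWeight (fun k : DualGroup Γ => k.eval γ) id (haarDual Γ) (haarDual Γ) where
  measurable := (DualGroup.continuous_eval γ).measurable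
  quasi := .id _
  lintegral_eq g _ := by
    refine lintegral_congr fun k => ?_
    have : ‖k.eval γ‖ₑ = 1 := by
      rw [← ofReal_norm, DualGroup.eval, Circle.norm_coe, ENNReal.ofReal_one]
    simp [this]

theorem weightedComp_eval_add (γ δ : Γ) (f : Lp ℂ 2 (haarDual Γ)) :
    weightedComp (isIsometricWeight_eval (γ + δ)) f =
      weightedComp (isIsometricWeight_eval γ) (weightedComp (isIsometricWeight_eval δ) f) := by
  refine Lp.ext ?_
  filter_upwards [coeFn_weightedComp (isIsometricWeight_eval (γ + δ)) f,
    coeFn_weightedComp (isIsometricWeight_eval γ) (weightedComp (isIsometricWeight_eval δ) f),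
    coeFn_weightedComp (isIsometricWeight_eval δ) f] with k h1 h2 h3
  rw [h1, h2, id, h3, ← mul_assoc]
  simp [DualGroup.eval]

theorem weightedComp_eval_zero (f : Lp ℂ 2 (haarDual Γ)) :
    weightedComp (isIsometricWeight_eval 0) f = f := by
  refine Lp.ext ?_
  filter_upwards [coeFn_weightedComp (isIsometricWeight_eval 0) f] with k h1
  rw [h1]
  simp [DualGroup.eval]

variable (Γ) in
/-- The unitary representation `μ` of `Γ` on `L²(Γ̂)`, `(μ_γ f)(k) = k(γ) f(k)`. -/
def modulation : Multiplicative Γ →* (Lp ℂ 2 (haarDual Γ) ≃ₗᵢ[ℂ] Lp ℂ 2 (haarDual Γ)) where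
  toFun γ :=
    { toLinearEquiv := LinearEquiv.ofLinearMap
        (weightedComp (isIsometricWeight_eval γ.toAdd)).toLinearMap
        (weightedComp (isIsometricWeight_eval (-γ.toAdd))).toLinearMap
        (LinearMap.ext fun f => by
          simp [← weightedComp_eval_add, weightedComp_eval_zero])
        (LinearMap.ext fun f => by
          simp [← weightedComp_eval_add, weightedComp_eval_zero])
      norm_map' := (weightedComp (isIsometricWeight_eval γ.toAdd)).norm_map }
  map_one' := LinearIsometryEquiv.ext weightedComp_eval_zero
  map_mul' γ δ := LinearIsometryEquiv.ext (weightedComp_eval_add γ.toAdd δ.toAdd)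

theorem filterIsometry_modulation [Countable Γ] {α : Γ →+ Γ} (hα : IsDilationEndo α)
    {m : DualGroup Γ → ℂ} (hm : IsFilter α m) (γ : Γ) (f : Lp ℂ 2 (haarDual Γ)) :
    filterIsometry hα hm (modulation Γ (.ofAdd γ) f) =
      modulation Γ (.ofAdd (α γ)) (filterIsometry hα hm f) := by
  refine Lp.ext ?_
  have h3 := coeFn_weightedComp (isIsometricWeight_eval γ) f
  filter_upwards [coeFn_weightedComp (hm.isIsometricWeight hα) (modulation Γ (.ofAdd γ) f),
    coeFn_weightedComp (isIsometricWeight_eval (α γ)) (filterIsometry hα hm f),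
    coeFn_weightedComp (hm.isIsometricWeight hα) f,
    (hm.isIsometricWeight hα).quasi.ae_eq_comp h3] with k h1 h2 h4 h5
  refine h1.trans (Eq.trans ?_ h2.symm)
  have h5' : (modulation Γ (.ofAdd γ) f : DualGroup Γ → ℂ) (dualEndo α k) =
    (dualEndo α k).eval γ * f (dualEndo α k) := h5
  have h4' : (filterIsometry hα hm f : DualGroup Γ → ℂ) k = m k * f (dualEndo α k) := h4
  rw [h5', id, h4', dualEndo_eval]
  ring

end Dual

section Solenoid

variable {Γ : Type*} [AddCommGroup Γ] [TopologicalSpace Γ] [DiscreteTopology Γ]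

/-- The solenoid `𝒮_{α^*} = lim← (Γ̂, α^*)`: sequences `ζ` in `Γ̂` with `α^*(ζ_{n+1}) = ζ_n`. -/
def Solenoid (α : Γ →+ Γ) : Type _ :=
  {ζ : ℕ → DualGroup Γ // ∀ n, dualEndo α (ζ (n + 1)) = ζ n}

namespace Solenoid

instance (α : Γ →+ Γ) : TopologicalSpace (Solenoid α) := instTopologicalSpaceSubtype

instance (α : Γ →+ Γ) : MeasurableSpace (Solenoid α) := borel _

instance (α : Γ →+ Γ) : BorelSpace (Solenoid α) := ⟨rfl⟩

variable {α : Γ →+ Γ}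

/-- The canonical map `π_n : 𝒮_{α^*} → Γ̂`. -/
def proj (n : ℕ) (ζ : Solenoid α) : DualGroup Γ := ζ.1 n

/-- The shift `h(ζ_0, ζ_1, …) = (α^*(ζ_0), ζ_0, ζ_1, …)`. -/
def shift (ζ : Solenoid α) : Solenoid α where
  val
    | 0 => dualEndo α (ζ.1 0)
    | n + 1 => ζ.1 n
  property
    | 0 => rfl
    | n + 1 => ζ.2 n

theorem continuous_proj (n : ℕ) : Continuous (proj n : Solenoid α → DualGroup Γ) :=
  (continuous_apply n).comp continuous_subtype_val

theorem dualEndo_iterate_proj (n k : ℕ) (ζ : Solenoid α) :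
    (dualEndo α)^[k] (proj (n + k) ζ) = proj n ζ := by
  induction k with
  | zero => rfl
  | succ k ih =>
    rw [Function.iterate_succ_apply]
    exact (congrArg _ (ζ.2 (n + k))).trans ih

instance : T2Space (Solenoid α) :=
  inferInstanceAs (T2Space {ζ : ℕ → DualGroup Γ // ∀ n, dualEndo α (ζ (n + 1)) = ζ n})

instance : CompactSpace (Solenoid α) := by
  suffices h : IsClosed {ζ : ℕ → DualGroup Γ | ∀ n, dualEndo α (ζ (n + 1)) = ζ n} from
    isCompact_iff_compactSpace.1 h.isCompact
  have : {ζ : ℕ → DualGroup Γ | ∀ n, dualEndo α (ζ (n + 1)) = ζ n} =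
      ⋂ n, {ζ | dualEndo α (ζ (n + 1)) = ζ n} := by ext; simp
  rw [this]
  exact isClosed_iInter fun n => isClosed_eq
    ((map_continuous (dualEndo α)).comp (continuous_apply _)) (continuous_apply _)

theorem proj_surjective (hα : Function.Injective α) (n : ℕ) :
    Function.Surjective (proj n : Solenoid α → DualGroup Γ) := by
  intro k
  choose c hc using dualEndo_surjective hα
  have hc' : ∀ j l, (dualEndo α) (c^[j + 1] l) = c^[j] l := fun j l => by
    rw [Function.iterate_succ_apply', hc]
  have hs : ∀ i, dualEndo α ((dualEndo α)^[n - (i + 1)] (c^[i + 1 - n] k)) =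
      (dualEndo α)^[n - i] (c^[i - n] k) := by
    intro i
    rcases lt_or_ge i n with h | h
    · have h1 : n - i = n - (i + 1) + 1 := by omega
      have h2 : i + 1 - n = 0 := by omega
      have h3 : i - n = 0 := by omega
      rw [h1, h2, h3, Function.iterate_succ_apply']
    · have h1 : n - (i + 1) = 0 := by omega
      have h2 : n - i = 0 := by omega
      have h3 : i + 1 - n = i - n + 1 := by omega
      rw [h1, h2, h3]
      exact hc' _ _
  exact ⟨⟨fun i => (dualEndo α)^[n - i] (c^[i - n] k), hs⟩, by simp [proj]⟩

end Solenoid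

variable (α : Γ →+ Γ) (m : DualGroup Γ → ℂ)

/-- The product `∏_{j<n} m ∘ α^{*j}` on `Γ̂`. -/
def filterProd (n : ℕ) (k : DualGroup Γ) : ℂ := ∏ j ∈ Finset.range n, m ((dualEndo α)^[j] k)

/-- The measure `τ_n` on `Γ̂` with density `∏_{j<n} |m ∘ α^{*j}|²` with respect to Haar measure. -/
def levelMeasure (n : ℕ) : Measure (DualGroup Γ) :=
  (haarDual Γ).withDensity fun k => ‖filterProd α m n k‖ₑ ^ 2

/-- The characterization of the measure `τ` on the solenoid: it is a probability measure and
`∫ (f ∘ π_n) dτ = ∫ f(k) ∏_{j<n} |m(α^{*j}(k))|² dk` for all `n` and all `f ∈ C(Γ̂)`. -/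
structure IsSolenoidMeasure (τ : Measure (Solenoid α)) : Prop where
  isProbabilityMeasure : IsProbabilityMeasure τ
  integral_comp_proj : ∀ (n : ℕ) (f : C(DualGroup Γ, ℂ)),
    ∫ ζ, f (Solenoid.proj n ζ) ∂τ =
      ∫ k, f k * ((∏ j ∈ Finset.range n, ‖m ((dualEndo α)^[j] k)‖ ^ 2 : ℝ) : ℂ) ∂(haarDual Γ)

variable {α m}

theorem measurable_filterProd (hm : Measurable m) (n : ℕ) : Measurable (filterProd α m n) :=
  Finset.measurable_fun_prod _ fun j _ => hm.comp ((map_continuous (dualEndo α)).iterate j).measurable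

theorem measurePreserving_levelMeasure [Countable Γ] (hα : IsDilationEndo α) (hm : IsFilter α m)
    (n : ℕ) : MeasurePreserving (dualEndo α) (levelMeasure α m (n + 1)) (levelMeasure α m n) where
  measurable := (map_continuous (dualEndo α)).measurable
  map_eq := by
    have hβ : Measurable (dualEndo α) := (map_continuous (dualEndo α)).measurable
    ext s hs
    rw [Measure.map_apply hβ hs, levelMeasure, levelMeasure, withDensity_apply _ hs,
      withDensity_apply _ (hβ hs), ← lintegral_indicator hs, ← lintegral_indicator (hβ hs),
      ← (hm.isIsometricWeight hα).lintegral_eq (s.indicator fun k => ‖filterProd α m n k‖ₑ ^ 2)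
        (((measurable_filterProd hm.measurable n).enorm.pow_const 2).indicator hs)]
    refine lintegral_congr fun k => ?_
    have h : filterProd α m (n + 1) k = m k * filterProd α m n (dualEndo α k) := by
      rw [filterProd, Finset.prod_range_succ', mul_comm]
      rfl
    by_cases hk : dualEndo α k ∈ s
    · rw [Set.indicator_of_mem (show k ∈ dualEndo α ⁻¹' s from hk), Set.indicator_of_mem hk, h,
        enorm_mul, mul_pow]
    · rw [Set.indicator_of_notMem (show k ∉ dualEndo α ⁻¹' s from hk),
        Set.indicator_of_notMem hk, mul_zero]

theorem measurePreserving_levelMeasure_iterate [Countable Γ] (hα : IsDilationEndo α)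
    (hm : IsFilter α m) (n k : ℕ) :
    MeasurePreserving (dualEndo α)^[k] (levelMeasure α m (n + k)) (levelMeasure α m n) := by
  induction k with
  | zero => exact .id _
  | succ k ih => exact ih.comp (measurePreserving_levelMeasure hα hm (n + k))

theorem levelMeasure_zero : levelMeasure α m 0 = haarDual Γ := by
  simp [levelMeasure, filterProd]

theorem isProbabilityMeasure_levelMeasure [Countable Γ] (hα : IsDilationEndo α)
    (hm : IsFilter α m) (n : ℕ) : IsProbabilityMeasure (levelMeasure α m n) := by
  have h := (measurePreserving_levelMeasure_iterate hα hm 0 n).measure_preimage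
    (MeasurableSet.univ.nullMeasurableSet)
  rw [Set.preimage_univ, zero_add, levelMeasure_zero] at h
  exact ⟨h.trans measure_univ⟩

theorem integral_levelMeasure (hm : Measurable m) (n : ℕ) (f : DualGroup Γ → ℂ) :
    ∫ k, f k ∂(levelMeasure α m n) =
      ∫ k, f k * ((∏ j ∈ Finset.range n, ‖m ((dualEndo α)^[j] k)‖ ^ 2 : ℝ) : ℂ) ∂(haarDual Γ) := by
  rw [levelMeasure, integral_withDensity_eq_integral_toReal_smul
    ((measurable_filterProd hm n).enorm.pow_const 2) (ae_of_all _ fun k => by simp)]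
  refine integral_congr_ae (ae_of_all _ fun k => ?_)
  simp [filterProd, mul_comm, Finset.prod_pow]

theorem isSolenoidMeasure_iff [Countable Γ] (hα : IsDilationEndo α) (hm : IsFilter α m)
    {τ : Measure (Solenoid α)} :
    IsSolenoidMeasure α m τ ↔ ∀ n, MeasurePreserving (Solenoid.proj n) τ (levelMeasure α m n) := by
  constructor
  · intro h n
    have := h.isProbabilityMeasure
    have := isProbabilityMeasure_levelMeasure hα hm n
    have hmeas : Measurable (Solenoid.proj n : Solenoid α → _) :=
      (Solenoid.continuous_proj n).measurable
    refine ⟨hmeas, ?_⟩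
    have := Measure.isProbabilityMeasure_map (μ := τ) hmeas.aemeasurable
    let _ := TopologicalSpace.metrizableSpaceMetric (DualGroup Γ)
    refine ext_of_forall_integral_eq_of_IsFiniteMeasure fun f => ?_
    rw [integral_map hmeas.aemeasurable f.continuous.aestronglyMeasurable]
    have h1 := h.integral_comp_proj n
      ⟨fun k => ((f k : ℝ) : ℂ), Complex.continuous_ofReal.comp f.continuous⟩
    rw [← integral_levelMeasure hm.measurable] at h1
    simp only [ContinuousMap.coe_mk] at h1
    exact Complex.ofReal_injective (integral_ofReal.symm.trans (h1.trans integral_ofReal))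
  · intro h
    refine ⟨⟨?_⟩, fun n f => ?_⟩
    · have := isProbabilityMeasure_levelMeasure hα hm 0
      have h0 := (h 0).measure_preimage (MeasurableSet.univ.nullMeasurableSet)
      rw [Set.preimage_univ] at h0
      exact h0.trans measure_univ
    · rw [← integral_levelMeasure hm.measurable, ← (h n).map_eq,
        integral_map (h n).measurable.aemeasurable f.continuous.aestronglyMeasurable]

/-- Uniqueness of the measure on the solenoid. -/
theorem IsSolenoidMeasure.unique [Countable Γ] (hα : IsDilationEndo α) (hm : IsFilter α m)
    {τ τ' : Measure (Solenoid α)} (h : IsSolenoidMeasure α m τ) (h' : IsSolenoidMeasure α m τ') :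
    τ = τ' := by
  have := h.isProbabilityMeasure
  have := h'.isProbabilityMeasure
  have h1 := (isSolenoidMeasure_iff hα hm).1 h
  have h2 := (isSolenoidMeasure_iff hα hm).1 h'
  let C : Set (Set (Solenoid α)) :=
    {t | ∃ n s, MeasurableSet s ∧ t = Solenoid.proj n ⁻¹' s}
  refine ext_of_generate_finite C ?_ ?_ ?_ (by simp)
  · have e1 : (inferInstance : MeasurableSpace (Solenoid α)) =
        MeasurableSpace.comap Subtype.val (borel (ℕ → DualGroup Γ)) := borel_comap
    have e2 : borel (ℕ → DualGroup Γ) = MeasurableSpace.pi := (BorelSpace.measurable_eq).symm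
    refine le_antisymm ?_ (MeasurableSpace.generateFrom_le ?_)
    · rw [e2] at e1
      refine e1.le.trans ?_
      rw [MeasurableSpace.pi, MeasurableSpace.comap_iSup]
      refine iSup_le fun n => ?_
      rw [MeasurableSpace.comap_comp]
      rintro _ ⟨s, hs, rfl⟩
      exact MeasurableSpace.measurableSet_generateFrom ⟨n, s, hs, rfl⟩
    · rintro _ ⟨n, s, hs, rfl⟩
      exact (Solenoid.continuous_proj n).measurable hs
  · rintro _ ⟨n, s, hs, rfl⟩ _ ⟨n', s', hs', rfl⟩ -
    have hβ := fun k => ((map_continuous (dualEndo α)).iterate k).measurable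
    refine ⟨n + n', (dualEndo α)^[n'] ⁻¹' s ∩ (dualEndo α)^[n] ⁻¹' s',
      (hβ _ hs).inter (hβ _ hs'), ?_⟩
    ext ζ
    simp only [Set.mem_inter_iff, Set.mem_preimage, Solenoid.dualEndo_iterate_proj]
    rw [add_comm n n', Solenoid.dualEndo_iterate_proj]
  · rintro _ ⟨n, s, hs, rfl⟩
    rw [(h1 n).measure_preimage hs.nullMeasurableSet, (h2 n).measure_preimage hs.nullMeasurableSet]

/-- Existence of the measure on the solenoid. -/
theorem exists_isSolenoidMeasure [Countable Γ] (hα : IsDilationEndo α) (hm : IsFilter α m) :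
    ∃ τ : Measure (Solenoid α), IsSolenoidMeasure α m τ := by
  have hP := isProbabilityMeasure_levelMeasure hα hm
  let pull (n : ℕ) (f : C(DualGroup Γ, ℝ)) : C(Solenoid α, ℝ) :=
    f.comp ⟨Solenoid.proj n, Solenoid.continuous_proj n⟩
  let I (n : ℕ) (f : C(DualGroup Γ, ℝ)) : ℝ := ∫ k, f k ∂(levelMeasure α m n)
  have hint : ∀ n (f : C(DualGroup Γ, ℝ)), Integrable f (levelMeasure α m n) := fun n f =>
    (BoundedContinuousFunction.mkOfCompact f).integrable _
  let it (k : ℕ) (f : C(DualGroup Γ, ℝ)) : C(DualGroup Γ, ℝ) :=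
    f.comp ⟨(dualEndo α)^[k], (map_continuous (dualEndo α)).iterate k⟩
  have hpull : ∀ n k f, pull (n + k) (it k f) = pull n f := fun n k f =>
    ContinuousMap.ext fun ζ => congrArg f (Solenoid.dualEndo_iterate_proj n k ζ)
  have hI : ∀ n k f, I (n + k) (it k f) = I n f := fun n k f => by
    have h := measurePreserving_levelMeasure_iterate hα hm n k
    simp only [I]
    rw [← h.map_eq, integral_map h.measurable.aemeasurable f.continuous.aestronglyMeasurable]
    rfl
  let M : Submodule ℝ (C(Solenoid α, ℝ) × ℝ) :=
    { carrier := {p | ∃ n f, p = (pull n f, I n f)}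
      zero_mem' := ⟨0, 0, by simp [pull, I]; rfl⟩
      add_mem' := by
        rintro _ _ ⟨n, f, rfl⟩ ⟨n', f', rfl⟩
        refine ⟨n + n', it n' f + it n f', ?_⟩
        rw [← hpull n n' f, ← hI n n' f, ← hpull n' n f', ← hI n' n f', add_comm n' n]
        refine Prod.ext rfl ?_
        exact (integral_add (hint _ _) (hint _ _)).symm
      smul_mem' := by
        rintro c _ ⟨n, f, rfl⟩
        exact ⟨n, c • f, Prod.ext rfl (integral_smul c f).symm⟩ }
  have hzero : ∀ p ∈ M, p.1 = 0 → p.2 = 0 := by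
    rintro _ ⟨n, f, rfl⟩ h
    have : f = 0 := ContinuousMap.ext fun k => by
      obtain ⟨ζ, rfl⟩ := Solenoid.proj_surjective hα.injective n k
      exact DFunLike.congr_fun h ζ
    simp [this, I]
  have hgraph : ∀ x : M.toLinearPMap.domain, ∃ n f, (x : C(Solenoid α, ℝ)) = pull n f ∧
      M.toLinearPMap x = I n f := fun x => by
    obtain ⟨n, f, h⟩ := M.mem_graph_toLinearPMap hzero x
    exact ⟨n, f, congrArg Prod.fst h, congrArg Prod.snd h⟩
  obtain ⟨g, hg, hg0⟩ := riesz_extension (PointedCone.positive ℝ C(Solenoid α, ℝ)) M.toLinearPMap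
    (by
      intro x hx
      obtain ⟨n, f, h1, h2⟩ := hgraph x
      rw [h2]
      refine integral_nonneg fun k => ?_
      obtain ⟨ζ, rfl⟩ := Solenoid.proj_surjective hα.injective n k
      have h3 : (0 : C(Solenoid α, ℝ)) ≤ pull n f := h1 ▸ hx
      exact h3 ζ)
    (by
      intro y
      refine ⟨⟨pull 0 (ContinuousMap.const _ ‖y‖), ?_⟩, ?_⟩
      · rw [Submodule.toLinearPMap_domain]
        exact ⟨_, ⟨0, _, rfl⟩, rfl⟩
      · rw [PointedCone.mem_positive, ContinuousMap.le_def]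
        intro ζ
        have := (abs_le.1 (y.norm_coe_le_norm ζ)).1
        simp only [pull, ContinuousMap.add_apply, ContinuousMap.comp_apply, ContinuousMap.const_apply,
          ContinuousMap.zero_apply]
        linarith)
  have hg1 : ∀ n f, g (pull n f) = I n f := fun n f => by
    have hmem : (pull n f) ∈ M.toLinearPMap.domain := by
      rw [Submodule.toLinearPMap_domain]
      exact ⟨_, ⟨n, f, rfl⟩, rfl⟩
    rw [hg ⟨_, hmem⟩]
    have h1 := M.mem_graph_toLinearPMap hzero ⟨_, hmem⟩
    have h2 := M.sub_mem h1 (show (pull n f, I n f) ∈ M from ⟨n, f, rfl⟩)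
    exact sub_eq_zero.1 (hzero _ h2 (sub_self _))
  let Λ : CompactlySupportedContinuousMap (Solenoid α) ℝ →ₚ[ℝ] ℝ := PositiveLinearMap.mk₀
    { toFun := fun F => g F.toContinuousMap
      map_add' := fun F F' => g.map_add _ _
      map_smul' := fun c F => g.map_smul _ _ } fun F hF => hg0 _ hF
  have hτ : ∀ n (f : C(DualGroup Γ, ℝ)),
      ∫ ζ, f (Solenoid.proj n ζ) ∂(RealRMK.rieszMeasure Λ) = I n f := fun n f => by
    rw [← hg1]
    exact RealRMK.integral_rieszMeasure Λ
      ⟨pull n f, HasCompactSupport.of_compactSpace _⟩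
  have hprob : IsProbabilityMeasure (RealRMK.rieszMeasure Λ) := by
    have h := hτ 0 (ContinuousMap.const _ 1)
    simp only [I, ContinuousMap.const_apply, integral_const, smul_eq_mul, mul_one,
      probReal_univ] at h
    refine ⟨?_⟩
    rw [measureReal_def] at h
    exact (ENNReal.toReal_eq_one_iff _).1 h
  refine ⟨RealRMK.rieszMeasure Λ, (isSolenoidMeasure_iff hα hm).2 fun n => ?_⟩
  have hmeas : Measurable (Solenoid.proj n : Solenoid α → _) :=
    (Solenoid.continuous_proj n).measurable
  refine ⟨hmeas, ?_⟩
  have := Measure.isProbabilityMeasure_map (μ := RealRMK.rieszMeasure Λ) hmeas.aemeasurable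
  let _ := TopologicalSpace.metrizableSpaceMetric (DualGroup Γ)
  refine ext_of_forall_integral_eq_of_IsFiniteMeasure fun f => ?_
  rw [integral_map hmeas.aemeasurable f.continuous.aestronglyMeasurable]
  exact hτ n f.toContinuousMap

/-- The measure `τ` on the solenoid: the unique probability measure on `𝒮_{α^*}` satisfying
`∫ (f ∘ π_n) dτ = ∫ f(k) ∏_{j<n} |m(α^{*j}(k))|² dk` for all `n` and all `f ∈ C(Γ̂)`. -/
def solenoidMeasure [Countable Γ] (hα : IsDilationEndo α) (hm : IsFilter α m) :
    Measure (Solenoid α) :=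
  (exists_isSolenoidMeasure hα hm).choose

theorem isSolenoidMeasure_solenoidMeasure [Countable Γ] (hα : IsDilationEndo α)
    (hm : IsFilter α m) : IsSolenoidMeasure α m (solenoidMeasure hα hm) :=
  (exists_isSolenoidMeasure hα hm).choose_spec

end Solenoid

end

noncomputable section SolenoidRealization

variable {Γ : Type*} [AddCommGroup Γ] [TopologicalSpace Γ] [DiscreteTopology Γ]
  {α : Γ →+ Γ} {m : DualGroup Γ → ℂ}

/-! Write `P_n` for `filterProd α m n` and `τ_n` for the measure `|P_n|² dk`. The defining property
of `τ` says that `π_n` carries `τ` to `τ_n`. As `m` is nonzero almost everywhere and `α^*` preserves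
Haar measure, `P_n` is nonzero almost everywhere, so `R_n f = (P_n ∘ π_n)⁻¹ · (f ∘ π_n)` is an
isometry of `L²(Γ̂)` into `L²(τ)`: the weight cancels the density. The identity `P_{n+1} = m · (P_n
∘ α^*)` gives `R_{n+1} S_m = R_n` (`levelEmbedding_succ`), so the `R_n` induce an isometry `R_∞` of
the direct limit, and `V_∞` is its inverse.

Surjectivity of `R_∞`: the range is closed and contains every `g ∘ π_n = R_n (g P_n)` with `g`
continuous. These functions form a star algebra separating points, which is dense in `C(𝒮)` by
Stone–Weierstrass and hence has dense image in `L²(τ)` (`mem_closure_comp_proj`). The same formula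
for `R_n (g P_n)` is (a).

For (b) and (c) it suffices to compare both sides on the ranges of the `U_n`. In (b), the operator
`f ↦ (m ∘ π_0) · (f ∘ h)` is isometric because `h` carries `|m ∘ π_0|² τ` to `τ`
(`map_shift_withDensity`, by uniqueness of `τ`), and the comparison reduces to two factorizations of
`P_{n+1}`. In (c) it reduces to `π_n(ζ)(αⁿ γ) = π_0(ζ)(γ)`. -/

theorem filterProd_succ (n : ℕ) (k : DualGroup Γ) :
    filterProd α m (n + 1) k = m k * filterProd α m n (dualEndo α k) := by
  rw [filterProd, Finset.prod_range_succ', mul_comm]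
  rfl

/-- Splitting off the last factor rather than the first. At `k = π_n(ζ)` this factor is `m(π_0(ζ))`,
which is how the weight in (b) arises. -/
theorem filterProd_succ' (n : ℕ) (k : DualGroup Γ) :
    filterProd α m (n + 1) k = filterProd α m n k * m ((dualEndo α)^[n] k) :=
  Finset.prod_range_succ _ _

/-! ### Coordinates on the solenoid and density of cylinder functions -/

namespace Solenoid

theorem dualEndo_proj_succ (n : ℕ) (ζ : Solenoid α) :
    dualEndo α (proj (n + 1) ζ) = proj n ζ :=
  ζ.2 n

theorem proj_shift (n : ℕ) (ζ : Solenoid α) : proj n (shift ζ) = dualEndo α (proj n ζ) := by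
  cases n with
  | zero => rfl
  | succ n => exact (ζ.2 n).symm

theorem eval_proj (γ : Γ) (n : ℕ) (ζ : Solenoid α) :
    (proj n ζ).eval (α^[n] γ) = (proj 0 ζ).eval γ := by
  induction n with
  | zero => rfl
  | succ n ih =>
    rw [Function.iterate_succ_apply', ← dualEndo_eval, dualEndo_proj_succ, ih]

theorem continuous_shift : Continuous (shift : Solenoid α → Solenoid α) := by
  refine Continuous.subtype_mk (continuous_pi fun n => ?_) _
  cases n with
  | zero => exact (map_continuous (dualEndo α)).comp (continuous_proj 0)
  | succ n => exact continuous_proj n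

instance [Countable Γ] : SecondCountableTopology (Solenoid α) :=
  Topology.IsInducing.subtypeVal.secondCountableTopology

variable (α) in
/-- The algebra of continuous functions on the solenoid which factor through some `π_n`. -/
def cylinderAlgebra : StarSubalgebra ℂ C(Solenoid α, ℂ) where
  carrier := {F | ∃ n, ∃ f : C(DualGroup Γ, ℂ), ∀ ζ, F ζ = f (proj n ζ)}
  mul_mem' := by
    rintro F G ⟨n, f, hf⟩ ⟨l, g, hg⟩
    -- Functions of levels `n` and `l` both become functions of level `n + l` by composing with
    -- iterates of `α^*`.
    refine ⟨n + l, f.comp ⟨_, (map_continuous (dualEndo α)).iterate l⟩ *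
      g.comp ⟨_, (map_continuous (dualEndo α)).iterate n⟩, fun ζ => ?_⟩
    have h := dualEndo_iterate_proj l n ζ
    rw [add_comm] at h
    simp [hf, hg, dualEndo_iterate_proj, h]
  add_mem' := by
    rintro F G ⟨n, f, hf⟩ ⟨l, g, hg⟩
    refine ⟨n + l, f.comp ⟨_, (map_continuous (dualEndo α)).iterate l⟩ +
      g.comp ⟨_, (map_continuous (dualEndo α)).iterate n⟩, fun ζ => ?_⟩
    have h := dualEndo_iterate_proj l n ζ
    rw [add_comm] at h
    simp [hf, hg, dualEndo_iterate_proj, h]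
  algebraMap_mem' c := ⟨0, algebraMap ℂ _ c, fun _ => rfl⟩
  star_mem' := by
    rintro F ⟨n, f, hf⟩
    exact ⟨n, star f, fun ζ => by simp [hf]⟩

/-- Stone–Weierstrass: distinct points of the solenoid differ in some coordinate, and two distinct
characters differ at some `γ`, so the functions `ζ ↦ π_n(ζ)(γ)` already separate points. -/
theorem cylinderAlgebra_topologicalClosure : (cylinderAlgebra α).topologicalClosure = ⊤ := by
  refine ContinuousMap.starSubalgebra_topologicalClosure_eq_top_of_separatesPoints _ ?_
  intro ζ ζ' h
  obtain ⟨n, hn⟩ : ∃ n, proj n ζ ≠ proj n ζ' := by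
    by_contra! h'
    exact h (Subtype.ext (funext h'))
  obtain ⟨γ, hγ⟩ : ∃ γ, (proj n ζ).eval γ ≠ (proj n ζ').eval γ := by
    by_contra! h'
    exact hn (PontryaginDual.ext fun γ => Subtype.ext (h' γ.toAdd))
  let f : C(DualGroup Γ, ℂ) := ⟨fun k => k.eval γ, DualGroup.continuous_eval γ⟩
  exact ⟨_, ⟨f.comp ⟨proj n, continuous_proj n⟩, ⟨n, f, fun _ => rfl⟩, rfl⟩, hγ⟩

end Solenoid

/-! ### Consequences of the almost everywhere nonvanishing of `m` -/

theorem ae_filter_ne_zero (hm0 : haarDual Γ {k | m k = 0} = 0) :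
    ∀ᵐ k ∂(haarDual Γ), m k ≠ 0 := by
  simpa [ae_iff] using hm0

theorem ae_filterProd_ne_zero (hα : IsDilationEndo α) (hm0 : haarDual Γ {k | m k = 0} = 0)
    (n : ℕ) : ∀ᵐ k ∂(haarDual Γ), filterProd α m n k ≠ 0 := by
  have h : ∀ j, ∀ᵐ k ∂(haarDual Γ), m ((dualEndo α)^[j] k) ≠ 0 := by
    intro j
    have h := ((measurePreserving_dualEndo hα.injective).iterate j).quasiMeasurePreserving
    exact h.ae (p := fun k => m k ≠ 0) (ae_filter_ne_zero hm0)
  filter_upwards [ae_all_iff.2 h] with k hk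
  exact Finset.prod_ne_zero_iff.2 fun j _ => hk j

/-- Multiplication by `P_n` turns the `L²(τ_n)` norm into the `L²` norm for Haar measure. -/
theorem memLp_mul_filterProd (hm : Measurable m) (hα : IsDilationEndo α)
    (hm0 : haarDual Γ {k | m k = 0} = 0) {n : ℕ} {g : DualGroup Γ → ℂ}
    (hg : MemLp g 2 (levelMeasure α m n)) :
    MemLp (fun k => g k * filterProd α m n k) 2 (haarDual Γ) := by
  have hw := measurable_filterProd (α := α) hm n
  have hw2 := hw.enorm.pow_const 2
  -- `g` is only known to be measurable up to `τ_n`-null sets; since the density is nonzero almost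
  -- everywhere, these are also Haar-null.
  have hac : haarDual Γ ≪ levelMeasure α m n := by
    refine withDensity_absolutelyContinuous' hw2.aemeasurable ?_
    filter_upwards [ae_filterProd_ne_zero hα hm0 n] with k hk
    simpa using hk
  refine ⟨(hg.1.mono_ac hac).mul hw.aestronglyMeasurable, ?_⟩
  have h := hg.2
  rw [eLpNorm_lt_top_iff_lintegral_rpow_enorm_lt_top two_ne_zero ENNReal.ofNat_ne_top] at h ⊢
  simp only [ENNReal.toReal_ofNat, ENNReal.rpow_ofNat] at h ⊢
  rw [levelMeasure, lintegral_withDensity_eq_lintegral_mul_non_measurable₀ _ hw2.aemeasurable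
    (ae_of_all _ fun k => by simp)] at h
  refine lt_of_eq_of_lt (lintegral_congr fun k => ?_) h
  rw [enorm_mul, mul_pow, mul_comm]
  rfl

variable [Countable Γ]

/-! ### The measure `τ` under the projections and the shift -/

section Measure

variable (hα : IsDilationEndo α) (hm : IsFilter α m)

instance : IsProbabilityMeasure (solenoidMeasure hα hm) :=
  (isSolenoidMeasure_solenoidMeasure hα hm).isProbabilityMeasure

theorem measurePreserving_proj (n : ℕ) :
    MeasurePreserving (Solenoid.proj n) (solenoidMeasure hα hm) (levelMeasure α m n) :=
  (isSolenoidMeasure_iff hα hm).1 (isSolenoidMeasure_solenoidMeasure hα hm) n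

/-- The image of `τ` is `τ_n`, which has a density. This lets identities holding Haar-almost
everywhere, in particular those for representatives of `L²` classes, be pulled back to the solenoid.
-/
theorem quasiMeasurePreserving_proj (n : ℕ) :
    Measure.QuasiMeasurePreserving (Solenoid.proj n) (solenoidMeasure hα hm) (haarDual Γ) where
  measurable := (measurePreserving_proj hα hm n).measurable
  absolutelyContinuous := by
    rw [(measurePreserving_proj hα hm n).map_eq]
    exact withDensity_absolutelyContinuous _ _

theorem lintegral_comp_proj {g : DualGroup Γ → ℝ≥0∞} (hg : Measurable g) (n : ℕ) :
    ∫⁻ ζ, g (Solenoid.proj n ζ) ∂(solenoidMeasure hα hm) =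
      ∫⁻ k, ‖filterProd α m n k‖ₑ ^ 2 * g k ∂(haarDual Γ) := by
  rw [(measurePreserving_proj hα hm n).lintegral_comp hg, levelMeasure,
    lintegral_withDensity_eq_lintegral_mul _
      ((measurable_filterProd hm.measurable n).enorm.pow_const 2) hg]
  rfl

/-- The shift pushes `|m ∘ π_0|² τ` forward to `τ`. -/
theorem map_shift_withDensity :
    ((solenoidMeasure hα hm).withDensity fun ζ => ‖m (Solenoid.proj 0 ζ)‖ₑ ^ 2).map
      Solenoid.shift = solenoidMeasure hα hm := by
  have hshift : Measurable (Solenoid.shift : Solenoid α → Solenoid α) :=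
    Solenoid.continuous_shift.measurable
  -- By uniqueness only the images under the `π_n` matter. Since `π_{n+1} ∘ h = π_n` and `π_0 =
  -- α^{*n} ∘ π_n`, the image at level `n + 1` is `|m ∘ α^{*n}|² τ_n = τ_{n+1}`.
  refine IsSolenoidMeasure.unique hα hm ((isSolenoidMeasure_iff hα hm).2 ?_)
    (isSolenoidMeasure_solenoidMeasure hα hm)
  have hsucc : ∀ n, MeasurePreserving (Solenoid.proj (n + 1))
      (((solenoidMeasure hα hm).withDensity fun ζ => ‖m (Solenoid.proj 0 ζ)‖ₑ ^ 2).map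
        Solenoid.shift) (levelMeasure α m (n + 1)) := by
    intro n
    have hp := (Solenoid.continuous_proj (α := α) (n + 1)).measurable
    have hβ := ((map_continuous (dualEndo α)).iterate n).measurable
    refine ⟨hp, ?_⟩
    ext s hs
    have hs' : MeasurableSet (Solenoid.proj (α := α) n ⁻¹' s) :=
      (Solenoid.continuous_proj n).measurable hs
    rw [Measure.map_apply hp hs, Measure.map_apply hshift (hp hs),
      show Solenoid.shift ⁻¹' (Solenoid.proj (α := α) (n + 1) ⁻¹' s) = Solenoid.proj n ⁻¹' s
        from rfl, withDensity_apply _ hs', ← lintegral_indicator hs']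
    have h1 := lintegral_comp_proj hα hm (n := n)
      (g := s.indicator fun k => ‖m ((dualEndo α)^[n] k)‖ₑ ^ 2)
      (((hm.measurable.comp hβ).enorm.pow_const 2).indicator hs)
    have h2 : (Solenoid.proj (α := α) n ⁻¹' s).indicator
        (fun ζ => ‖m (Solenoid.proj 0 ζ)‖ₑ ^ 2) = fun ζ =>
        s.indicator (fun k => ‖m ((dualEndo α)^[n] k)‖ₑ ^ 2) (Solenoid.proj n ζ) := by
      ext ζ
      have h := Solenoid.dualEndo_iterate_proj 0 n ζ
      rw [zero_add] at h
      simp only [Set.indicator, Set.mem_preimage, h]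
      rfl
    rw [h2, h1, levelMeasure, withDensity_apply _ hs, ← lintegral_indicator hs]
    refine lintegral_congr fun k => ?_
    by_cases hk : k ∈ s
    · rw [Set.indicator_of_mem hk, Set.indicator_of_mem hk, filterProd_succ', enorm_mul, mul_pow]
    · rw [Set.indicator_of_notMem hk, Set.indicator_of_notMem hk, mul_zero]
  rintro (_ | n)
  -- Level `0` is not of the form `n + 1`; it follows from level `1` through `π_0 = α^* ∘ π_1`.
  · have h := (measurePreserving_levelMeasure hα hm 0).comp (hsucc 0)
    exact (show _ ∘ _ = Solenoid.proj 0 from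
      funext (Solenoid.dualEndo_proj_succ (α := α) 0)) ▸ h
  · exact hsucc n

theorem isIsometricWeight_eval_proj (γ : Γ) :
    IsIsometricWeight (fun ζ : Solenoid α => (Solenoid.proj 0 ζ).eval γ) id
      (solenoidMeasure hα hm) (solenoidMeasure hα hm) where
  measurable := ((DualGroup.continuous_eval γ).comp (Solenoid.continuous_proj 0)).measurable
  quasi := .id _
  lintegral_eq g _ := by
    refine lintegral_congr fun ζ => ?_
    have : ‖(Solenoid.proj 0 ζ).eval γ‖ₑ = 1 := by
      rw [← ofReal_norm, DualGroup.eval, Circle.norm_coe, ENNReal.ofReal_one]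
    simp [this]

theorem mem_closure_comp_proj (f : Lp ℂ 2 (solenoidMeasure hα hm)) :
    f ∈ closure {F : Lp ℂ 2 (solenoidMeasure hα hm) | ∃ n, ∃ g : C(DualGroup Γ, ℂ),
      F =ᵐ[solenoidMeasure hα hm] fun ζ => g (Solenoid.proj n ζ)} := by
  -- The solenoid is compact, Hausdorff and second countable, hence metrizable; this gives the
  -- regularity of `τ` needed for density of `C(𝒮)` in `L²(τ)`.
  let _ := TopologicalSpace.metrizableSpaceMetric (Solenoid α)
  have hd := (ContinuousMap.toLp_denseRange ℂ (solenoidMeasure hα hm) ℂ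
    (p := 2) ENNReal.ofNat_ne_top)
  have hA : Dense (Solenoid.cylinderAlgebra α : Set C(Solenoid α, ℂ)) := fun F => by
    have h : F ∈ (Solenoid.cylinderAlgebra α).topologicalClosure := by
      rw [Solenoid.cylinderAlgebra_topologicalClosure]
      trivial
    exact h
  refine closure_mono ?_ (hd.dense_image (ContinuousLinearMap.continuous _) hA f)
  rintro _ ⟨F, ⟨n, g, hg⟩, rfl⟩
  exact ⟨n, g, (ContinuousMap.coeFn_toLp _ F).trans (ae_of_all _ hg)⟩

end Measure

/-! ### The isometries `R_n` and the unitary `V_∞` -/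

section NonvanishingFilter

variable (hα : IsDilationEndo α) (hm : IsFilter α m) (hm0 : haarDual Γ {k | m k = 0} = 0)

/-- Pushing forward to `τ_n` produces the density `|P_n|²`, which cancels the weight `|P_n|⁻²`. The
convention `0⁻¹ = 0` matters only on the null set where `P_n` vanishes. -/
theorem isIsometricWeight_inv_filterProd (hm0 : haarDual Γ {k | m k = 0} = 0) (n : ℕ) :
    IsIsometricWeight (fun ζ : Solenoid α => (filterProd α m n (Solenoid.proj n ζ))⁻¹)
      (Solenoid.proj n) (solenoidMeasure hα hm) (haarDual Γ) where
  measurable := ((measurable_filterProd hm.measurable n).comp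
    (Solenoid.continuous_proj n).measurable).inv
  quasi := quasiMeasurePreserving_proj hα hm n
  lintegral_eq g hg := by
    rw [lintegral_comp_proj hα hm (n := n)
      (g := fun k => ‖(filterProd α m n k)⁻¹‖ₑ ^ 2 * g k)
      (((measurable_filterProd hm.measurable n).inv.enorm.pow_const 2).mul hg)]
    refine lintegral_congr_ae ?_
    filter_upwards [ae_filterProd_ne_zero hα hm0 n] with k hk
    rw [← mul_assoc, ← mul_pow, ← enorm_mul, mul_inv_cancel₀ hk]
    simp

/-- The isometry `f ↦ (∏_{j<n} m ∘ α^{*j} ∘ π_n)⁻¹ · (f ∘ π_n)` of `L²(Γ̂)` into `L²(𝒮, τ)`. -/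
def levelEmbedding (n : ℕ) : Lp ℂ 2 (haarDual Γ) →ₗᵢ[ℂ] Lp ℂ 2 (solenoidMeasure hα hm) :=
  weightedComp (isIsometricWeight_inv_filterProd hα hm hm0 n)

theorem coeFn_levelEmbedding (n : ℕ) (f : Lp ℂ 2 (haarDual Γ)) :
    levelEmbedding hα hm hm0 n f =ᵐ[solenoidMeasure hα hm]
      fun ζ => (filterProd α m n (Solenoid.proj n ζ))⁻¹ * f (Solenoid.proj n ζ) :=
  coeFn_weightedComp (isIsometricWeight_inv_filterProd hα hm hm0 n) f

theorem levelEmbedding_toLp {n : ℕ} {f : DualGroup Γ → ℂ} (hf : MemLp f 2 (haarDual Γ)) :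
    levelEmbedding hα hm hm0 n (hf.toLp f) =ᵐ[solenoidMeasure hα hm]
      fun ζ => (filterProd α m n (Solenoid.proj n ζ))⁻¹ * f (Solenoid.proj n ζ) := by
  filter_upwards [coeFn_levelEmbedding hα hm hm0 n (hf.toLp f),
    (quasiMeasurePreserving_proj hα hm n).ae_eq_comp hf.coeFn_toLp] with ζ h1 h2
  rw [h1]
  exact congrArg _ h2

theorem coeFn_filterIsometry (f : Lp ℂ 2 (haarDual Γ)) :
    filterIsometry hα hm f =ᵐ[haarDual Γ] fun k => m k * f (dualEndo α k) :=
  coeFn_weightedComp (hm.isIsometricWeight hα) f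

theorem coeFn_levelEmbedding_filterIsometry (n : ℕ) (f : Lp ℂ 2 (haarDual Γ)) :
    levelEmbedding hα hm hm0 n (filterIsometry hα hm f) =ᵐ[solenoidMeasure hα hm]
      fun ζ => (filterProd α m n (Solenoid.proj n ζ))⁻¹ *
        (m (Solenoid.proj n ζ) * f (dualEndo α (Solenoid.proj n ζ))) := by
  filter_upwards [coeFn_levelEmbedding hα hm hm0 n (filterIsometry hα hm f),
    (quasiMeasurePreserving_proj hα hm n).ae_eq_comp (coeFn_filterIsometry hα hm f)]
    with ζ h1 h2
  rw [h1]
  exact congrArg _ h2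

theorem levelEmbedding_succ (n : ℕ) (f : Lp ℂ 2 (haarDual Γ)) :
    levelEmbedding hα hm hm0 (n + 1) (filterIsometry hα hm f) = levelEmbedding hα hm hm0 n f := by
  refine Lp.ext ?_
  filter_upwards [coeFn_levelEmbedding_filterIsometry hα hm hm0 (n + 1) f,
    coeFn_levelEmbedding hα hm hm0 n f,
    (quasiMeasurePreserving_proj hα hm (n + 1)).ae (ae_filter_ne_zero hm0)] with ζ h1 h2 h3
  -- `P_{n+1}(π_{n+1}(ζ)) = m(π_{n+1}(ζ)) P_n(π_n(ζ))`, and the first factor cancels the `m` coming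
  -- from `S_m`.
  rw [h1, h2, filterProd_succ, Solenoid.dualEndo_proj_succ, mul_inv]
  field_simp

/-- The isometry of `L²(Γ̂)_∞` into `L²(𝒮, τ)` induced by the `levelEmbedding`s. -/
def solenoidEmbedding :
    HilbertDirectLimit (filterIsometry hα hm) →ₗᵢ[ℂ] Lp ℂ 2 (solenoidMeasure hα hm) :=
  HilbertDirectLimit.lift _ (levelEmbedding hα hm hm0) (levelEmbedding_succ hα hm hm0)

theorem solenoidEmbedding_U (n : ℕ) (f : Lp ℂ 2 (haarDual Γ)) :
    solenoidEmbedding hα hm hm0 (HilbertDirectLimit.U _ n f) = levelEmbedding hα hm hm0 n f :=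
  HilbertDirectLimit.lift_U _ _ _ n f

/-- This is (a) read through the inverse of `V_∞`; it also puts the cylinder functions in the range
of `R_∞`. -/
theorem levelEmbedding_mul_filterProd {n : ℕ} {g : DualGroup Γ → ℂ}
    (hg : MemLp (fun k => g k * filterProd α m n k) 2 (haarDual Γ)) :
    levelEmbedding hα hm hm0 n (hg.toLp _) =ᵐ[solenoidMeasure hα hm]
      fun ζ => g (Solenoid.proj n ζ) := by
  filter_upwards [levelEmbedding_toLp hα hm hm0 hg,
    (quasiMeasurePreserving_proj hα hm n).ae (ae_filterProd_ne_zero hα hm0 n)] with ζ h1 h2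
  rw [h1]
  field_simp

theorem solenoidEmbedding_surjective : Function.Surjective (solenoidEmbedding hα hm hm0) := by
  intro f
  -- An isometry from a complete space has closed range, so a dense set of values is enough.
  have hc : IsClosed (Set.range (solenoidEmbedding hα hm hm0)) :=
    (solenoidEmbedding hα hm hm0).isometry.isClosedEmbedding.isClosed_range
  refine hc.closure_subset_iff.2 ?_ (mem_closure_comp_proj hα hm f)
  rintro F ⟨n, g, hF⟩
  have := isProbabilityMeasure_levelMeasure hα hm n
  have hg := memLp_mul_filterProd hm.measurable hα hm0 (n := n)
    ((BoundedContinuousFunction.mkOfCompact g).memLp_top.mono_exponent le_top (p := 2))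
  refine ⟨HilbertDirectLimit.U _ n (hg.toLp _), Lp.ext ?_⟩
  rw [solenoidEmbedding_U]
  exact (levelEmbedding_mul_filterProd hα hm hm0 hg).trans hF.symm

/-- The unitary isomorphism `V_∞` of `L²(𝒮, τ)` onto `L²(Γ̂)_∞`. -/
def solenoidUnitary :
    Lp ℂ 2 (solenoidMeasure hα hm) ≃ₗᵢ[ℂ] HilbertDirectLimit (filterIsometry hα hm) :=
  (LinearIsometryEquiv.ofSurjective _ (solenoidEmbedding_surjective hα hm hm0)).symm

theorem solenoidUnitary_symm_apply (z : HilbertDirectLimit (filterIsometry hα hm)) :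
    (solenoidUnitary hα hm hm0).symm z = solenoidEmbedding hα hm hm0 z := rfl

/-! ### Intertwining with `S_∞` and `μ_∞` -/

theorem isIsometricWeight_shift (hm0 : haarDual Γ {k | m k = 0} = 0) :
    IsIsometricWeight (fun ζ : Solenoid α => m (Solenoid.proj 0 ζ)) Solenoid.shift
      (solenoidMeasure hα hm) (solenoidMeasure hα hm) := by
  have hmeas : Measurable fun ζ : Solenoid α => m (Solenoid.proj 0 ζ) :=
    hm.measurable.comp (Solenoid.continuous_proj 0).measurable
  have hshift : Measurable (Solenoid.shift : Solenoid α → Solenoid α) :=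
    Solenoid.continuous_shift.measurable
  refine ⟨hmeas, ⟨hshift, ?_⟩, fun g hg => ?_⟩
  -- Composition with `h` must respect `τ`-null sets. Since `m ∘ π_0` is nonzero `τ`-almost
  -- everywhere, `τ ≪ |m ∘ π_0|² τ`, and pushing forward by `h` turns the right side into `τ`.
  · have hac : solenoidMeasure hα hm ≪
        (solenoidMeasure hα hm).withDensity fun ζ => ‖m (Solenoid.proj 0 ζ)‖ₑ ^ 2 := by
      refine withDensity_absolutelyContinuous' (hmeas.enorm.pow_const 2).aemeasurable ?_
      filter_upwards [(quasiMeasurePreserving_proj hα hm 0).ae (ae_filter_ne_zero hm0)] with ζ hζ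
      simpa using hζ
    have h := hac.map hshift
    rwa [map_shift_withDensity] at h
  · conv_rhs => rw [← map_shift_withDensity hα hm, lintegral_map hg hshift]
    exact (lintegral_withDensity_eq_lintegral_mul _ (hmeas.enorm.pow_const 2)
      (hg.comp hshift)).symm

theorem solenoidEmbedding_dilation (z : HilbertDirectLimit (filterIsometry hα hm)) :
    solenoidEmbedding hα hm hm0 (HilbertDirectLimit.dilation (filterIsometry hα hm) z) =
      weightedComp (isIsometricWeight_shift hα hm hm0) (solenoidEmbedding hα hm hm0 z) := by
  refine congrFun (HilbertDirectLimit.ext_U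
    ((solenoidEmbedding hα hm hm0).continuous.comp (LinearIsometryEquiv.continuous _))
    ((LinearIsometry.continuous _).comp (solenoidEmbedding hα hm hm0).continuous)
    fun n f => ?_) z
  simp only [Function.comp_apply]
  rw [HilbertDirectLimit.dilation_U, solenoidEmbedding_U, solenoidEmbedding_U]
  refine Lp.ext ?_
  filter_upwards [coeFn_levelEmbedding_filterIsometry hα hm hm0 n f,
    coeFn_weightedComp (isIsometricWeight_shift hα hm hm0) (levelEmbedding hα hm hm0 n f),
    (isIsometricWeight_shift hα hm hm0).quasi.ae_eq_comp (coeFn_levelEmbedding hα hm hm0 n f),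
    (quasiMeasurePreserving_proj hα hm n).ae (ae_filterProd_ne_zero hα hm0 n),
    (quasiMeasurePreserving_proj hα hm n).ae (ae_filterProd_ne_zero hα hm0 (n + 1))]
    with ζ h1 h2 h3 h4 h5
  simp only [Function.comp_apply, Solenoid.proj_shift] at h3
  rw [h1, h2, h3]
  -- With `k = π_n(ζ)`, the claim is `m(k) P_n(α^* k) = P_n(k) m(π_0(ζ))` after clearing
  -- denominators. Both sides are `P_{n+1}(k)`.
  have h6 := filterProd_succ (α := α) (m := m) n (Solenoid.proj n ζ)
  rw [h6] at h5
  have h7 := Solenoid.dualEndo_iterate_proj 0 n ζ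
  rw [zero_add] at h7
  rw [filterProd_succ', h7] at h6
  -- The denominator `P_n(α^* k)` is nonzero as a factor of `P_{n+1}(k)`.
  have h8 := right_ne_zero_of_mul h5
  field_simp
  linear_combination (-f (dualEndo α (Solenoid.proj n ζ))) * h6

theorem solenoidEmbedding_translation (γ : Γ)
    (z : HilbertDirectLimit (filterIsometry hα hm)) :
    solenoidEmbedding hα hm hm0 (HilbertDirectLimit.translation (filterIsometry hα hm) α
        (modulation Γ) (filterIsometry_modulation hα hm) (.ofAdd γ) z) =
      weightedComp (isIsometricWeight_eval_proj hα hm γ) (solenoidEmbedding hα hm hm0 z) := by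
  refine congrFun (HilbertDirectLimit.ext_U
    ((solenoidEmbedding hα hm hm0).continuous.comp (LinearIsometryEquiv.continuous _))
    ((LinearIsometry.continuous _).comp (solenoidEmbedding hα hm hm0).continuous)
    fun n f => ?_) z
  simp only [Function.comp_apply]
  rw [HilbertDirectLimit.translation_U, solenoidEmbedding_U, solenoidEmbedding_U]
  refine Lp.ext ?_
  have hmod : modulation Γ (.ofAdd (α^[n] γ)) f =ᵐ[haarDual Γ]
      fun k => k.eval (α^[n] γ) * f k := coeFn_weightedComp (isIsometricWeight_eval (α^[n] γ)) f
  filter_upwards [coeFn_levelEmbedding hα hm hm0 n (modulation Γ (.ofAdd (α^[n] γ)) f),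
    (quasiMeasurePreserving_proj hα hm n).ae_eq_comp hmod,
    coeFn_weightedComp (isIsometricWeight_eval_proj hα hm γ) (levelEmbedding hα hm hm0 n f),
    coeFn_levelEmbedding hα hm hm0 n f] with ζ h1 h2 h3 h4
  simp only [Function.comp_apply] at h2
  rw [h1, h2, h3, id, h4, Solenoid.eval_proj]
  ring

end NonvanishingFilter

end SolenoidRealization

/-! ### Properties (a), (b) and (c) of `V_∞` -/

theorem theorem6p4 {Γ : Type*} [AddCommGroup Γ] [Countable Γ] [TopologicalSpace Γ]
    [DiscreteTopology Γ] (α : Γ →+ Γ) (hα : IsDilationEndo α)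
    (m : DualGroup Γ → ℂ) (hm : IsFilter α m) (hm0 : haarDual Γ {k | m k = 0} = 0) :
    ∃ V : Lp ℂ 2 (solenoidMeasure hα hm) ≃ₗᵢ[ℂ] HilbertDirectLimit (filterIsometry hα hm),
      (∀ (n : ℕ) (g : DualGroup Γ → ℂ), MemLp g 2 (levelMeasure α m n) →
        ∃ (h₁ : MemLp (fun ζ : Solenoid α => g (Solenoid.proj n ζ)) 2 (solenoidMeasure hα hm))
          (h₂ : MemLp (fun k => g k * filterProd α m n k) 2 (haarDual Γ)),
          V (h₁.toLp (fun ζ : Solenoid α => g (Solenoid.proj n ζ))) =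
            HilbertDirectLimit.U (filterIsometry hα hm) n
              (h₂.toLp (fun k => g k * filterProd α m n k))) ∧
      (∀ f : Lp ℂ 2 (solenoidMeasure hα hm),
        V.symm (HilbertDirectLimit.dilation (filterIsometry hα hm) (V f))
          =ᵐ[solenoidMeasure hα hm]
            fun ζ => m (Solenoid.proj 0 ζ) * f (Solenoid.shift ζ)) ∧
      (∀ (γ : Γ) (f : Lp ℂ 2 (solenoidMeasure hα hm)),
        V.symm (HilbertDirectLimit.translation (filterIsometry hα hm) α (modulation Γ)
            (filterIsometry_modulation hα hm) (Multiplicative.ofAdd γ) (V f))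
          =ᵐ[solenoidMeasure hα hm]
            fun ζ => (Solenoid.proj 0 ζ).eval γ * f ζ) := by
  refine ⟨solenoidUnitary hα hm hm0, fun n g hg => ?_, fun f => ?_, fun γ f => ?_⟩
  · refine ⟨hg.comp_measurePreserving (measurePreserving_proj hα hm n),
      memLp_mul_filterProd hm.measurable hα hm0 hg, ?_⟩
    -- Only the inverse of `V_∞` has an explicit formula on the ranges of the `U_n`, so the equation
    -- is moved to `L²(τ)`.
    rw [← LinearIsometryEquiv.eq_symm_apply, solenoidUnitary_symm_apply, solenoidEmbedding_U]
    exact Lp.ext ((MemLp.coeFn_toLp _).trans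
      (levelEmbedding_mul_filterProd hα hm hm0 _).symm)
  · rw [solenoidUnitary_symm_apply, solenoidEmbedding_dilation, ← solenoidUnitary_symm_apply,
      LinearIsometryEquiv.symm_apply_apply]
    exact coeFn_weightedComp _ f
  · rw [solenoidUnitary_symm_apply, solenoidEmbedding_translation, ← solenoidUnitary_symm_apply,
      LinearIsometryEquiv.symm_apply_apply]
    exact coeFn_weightedComp _ f
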